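/- **Setting.** Let $(W,S)$ be a Coxeter system with length function $\ell$, Bruhat order $\le$ and left weak order $\le_L$ ($x\le_L y$ iff $y=zx$ with $\ell(y)=\ell(z)+\ell(x)$); put $\epsilon_w=(-1)^{\ell(w)}$. Let $\Lambda$ be a totally ordered abelian group and let $L(s)\in\Lambda$ $(s\in S)$ satisfy $L(s)\ge 0$ and $L(s)=L(t)$ whenever $s,t\in S$ are conjugate in $W$. Let $R\subseteq\mathbb C$ be a subring and $A=R[\Lambda]$ the group ring with $R$-basis $\{q^\gamma\mid\gamma\in\Lambda\}$, with the bar automorphism $\overline{q^\gamma}=q^{-\gamma}$; $A_{>0}$ and $A_{<0}$ are the $R$-spans of the $q^\gamma$ with $\gamma>0$, resp. $\gamma<0$. Let $\mathcal H$ be the Hecke algebra of $(W,S,L)$ over $A$: it is generated by $T_s$ $(s\in S)$ subject to $T_s^2=1+(q^{L(s)}-q^{-L(s)})T_s$ and the braid relations. Its bar involution is the ring automorphism extending the bar of $A$ with $\overline{T_s}=T_s^{-1}$, and $\Phi:\mathcal H\to\mathcal H$ is the $A$-algebra map with $\Phi(T_s)=-T_s^{-1}$, i.e. $\Phi(T_w)=\epsilon_w\overline{T_w}$.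 Let $J\subseteq S$ and $D_J=\{w\in W\mid \ell(ws)>\ell(w)\text{ for all }s\in J\}$. Let $\mathbf E_J\subseteq D_J$ be a non-empty subset of $W$ which is an ideal for $\le_L$ (closed under passing to $\le_L$-smaller elements). For $s\in S$ put $$\begin{aligned}\mathbf E_{J,s}^-&=\{w\in\mathbf E_J\mid \ell(sw)<\ell(w),\ sw\in\mathbf E_J\},&\mathbf E_{J,s}^+&=\{w\in\mathbf E_J\mid \ell(sw)>\ell(w),\ sw\in\mathbf E_J\},\\ \mathbf E_{J,s}^{0,-}&=\{w\in\mathbf E_J\mid \ell(sw)>\ell(w),\ sw\notin D_J\},&\mathbf E_{J,s}^{0,+}&=\{w\in\mathbf E_J\mid \ell(sw)>\ell(w),\ sw\in D_J\setminus\mathbf E_J\}.\end{aligned}$$ $\mathbf E_J$ is called a *$W$-graph ideal* with respect to $J$ and $L$ if there is an $\mathcal H$-module $M=M(\mathbf E_J,L)$ with an $A$-basis $\{\Gamma_w\mid w\in\mathbf E_J\}$ such that for all $s\in S$, $w\in\mathbf E_J$ $$T_s\Gamma_w=\begin{cases}\Gamma_{sw}+(q^{L(s)}-q^{-L(s)})\Gamma_w&w\in\mathbf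 E_{J,s}^-,\\ \Gamma_{sw}&w\in\mathbf E_{J,s}^+,\\ -q^{-L(s)}\Gamma_w&w\in\mathbf E_{J,s}^{0,-},\\ q^{L(s)}\Gamma_w-\sum_{z\in\mathbf E_J,\,z<w}r^s_{z,w}\Gamma_z&w\in\mathbf E_{J,s}^{0,+},\end{cases}$$ with $r^s_{z,w}\in q^{L(s)}A_{>0}$, and such that $M$ has an $A$-semilinear involution $\alpha\mapsto\overline\alpha$ (semilinear with respect to the bar of $A$) with $\overline{\Gamma_1}=\Gamma_1$ and $\overline{h\alpha}=\overline h\,\overline\alpha$ for all $h\in\mathcal H$, $\alpha\in M$. **Theorem.** Let $\mathbf E_J$ be a $W$-graph ideal with respect to $J$ and $L$, and let $M$, with its basis $(\Gamma_w)$, elements $r^s_{z,w}$ and bar involution, be any such module. (I) There is an $\mathcal H$-module $\widetilde M$ with an $A$-basis $\{\widetilde\Gamma_w\mid w\in\mathbf E_J\}$ such that for all $s\in S$, $w\in\mathbf E_J$ $$T_s\widetilde\Gamma_w=\begin{cases}\widetilde\Gamma_{sw}+(q^{L(s)}-q^{-L(s)})\widetilde\Gamma_w&w\in\mathbf E_{J,s}^-,\\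 \widetilde\Gamma_{sw}&w\in\mathbf E_{J,s}^+,\\ q^{L(s)}\widetilde\Gamma_w&w\in\mathbf E_{J,s}^{0,-},\\ -q^{-L(s)}\widetilde\Gamma_w+\sum_{z\in\mathbf E_J,\,z<w}\widetilde r^s_{z,w}\widetilde\Gamma_z&w\in\mathbf E_{J,s}^{0,+},\end{cases}$$ where $\widetilde r^s_{z,w}=\epsilon_z\epsilon_w\overline{r^s_{z,w}}\in q^{-L(s)}A_{<0}$, and such that $\widetilde M$ has an $A$-semilinear involution $\alpha\mapsto\overline\alpha$ with $\overline{\widetilde\Gamma_1}=\widetilde\Gamma_1$ and $\overline{h\alpha}=\overline h\,\overline\alpha$ for all $h\in\mathcal H$, $\alpha\in\widetilde M$. (II) For every $\widetilde M$, with basis and involution, as in (I) there is a unique map $\eta:M\to\widetilde M$ with $\eta(\Gamma_1)=\widetilde\Gamma_1$ and $\eta(h\alpha)=\Phi(h)\eta(\alpha)$ for all $h\in\mathcal H$, $\alpha\in M$. This $\eta$ is additive, it satisfies $\eta(\overline\alpha)=\overline{\eta(\alpha)}$ for all $\alpha\in M$, and it is bijective. Its inverse $\theta:\widetilde M\to M$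 is additive and satisfies $\theta(\widetilde\Gamma_1)=\Gamma_1$ and $\theta(h\alpha)=\Phi(h)\theta(\alpha)$ for all $h\in\mathcal H$, $\alpha\in\widetilde M$. -/

import Mathlib

universe v v'

noncomputable section

open CoxeterSystem

/-! ## The ring `A = k[Λ]` of generalized Laurent polynomials -/

section Coefficients

variable (k : Type*) [CommRing k] {Λ : Type*} [AddCommGroup Λ]

/-- The element `q ^ γ` of `A = k[Λ]`. -/
def qpow (γ : Λ) : AddMonoidAlgebra k Λ := AddMonoidAlgebra.single γ 1

variable (Λ) in
/-- The bar automorphism of `A`: the `k`-linear map with `q ^ γ ↦ q ^ (-γ)`. -/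
def barA : AddMonoidAlgebra k Λ →+* AddMonoidAlgebra k Λ :=
  AddMonoidAlgebra.mapDomainRingHom k (-(AddMonoidHom.id Λ))

variable {k}

/-- `a ∈ A_{> 0}`: every exponent that occurs in `a` is positive. -/
def IsPosPart [LinearOrder Λ] (a : AddMonoidAlgebra k Λ) : Prop := ∀ γ ∈ a.coeff.support, 0 < γ

/-- `a ∈ A_{< 0}`: every exponent that occurs in `a` is negative. -/
def IsNegPart [LinearOrder Λ] (a : AddMonoidAlgebra k Λ) : Prop := ∀ γ ∈ a.coeff.support, γ < 0

theorem barA_qpow (γ : Λ) : barA k Λ (qpow k γ) = qpow k (-γ) := by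
  simp [barA, qpow]

theorem qpow_mul_qpow (γ δ : Λ) : qpow k γ * qpow k δ = qpow k (γ + δ) := by
  simp [qpow, AddMonoidAlgebra.single_mul_single]

end Coefficients

/-! ## The Iwahori-Hecke algebra -/

section Hecke

variable (k : Type*) [CommRing k] {B : Type*} {Λ : Type*} [AddCommGroup Λ]

/-- The parameter `q ^ L(s) - q ^ (-L(s))` of the generator `s`. -/
def heckeParam (L : B → Λ) (s : B) : AddMonoidAlgebra k Λ := qpow k (L s) - qpow k (-(L s))

/-- The defining relations of the Hecke algebra: the quadratic relations
`T_s ^ 2 = 1 + (q ^ L(s) - q ^ (-L(s))) T_s`, and the braid relations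
`T_s T_t T_s ⋯ = T_t T_s T_t ⋯` with `m(s, t)` factors on both sides (in the convention of Mathlib
`m(s, t) = 0` stands for infinite order; the relation then reads `1 = 1`). -/
inductive HeckeRel (M : CoxeterMatrix B) (L : B → Λ) :
    FreeAlgebra (AddMonoidAlgebra k Λ) B → FreeAlgebra (AddMonoidAlgebra k Λ) B → Prop
  | quad (s : B) : HeckeRel M L
      (FreeAlgebra.ι (AddMonoidAlgebra k Λ) s * FreeAlgebra.ι (AddMonoidAlgebra k Λ) s)
      (1 + heckeParam k L s • FreeAlgebra.ι (AddMonoidAlgebra k Λ) s)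
  | braid (s t : B) : HeckeRel M L
      ((braidWord M s t).map (FreeAlgebra.ι (AddMonoidAlgebra k Λ))).prod
      ((braidWord M t s).map (FreeAlgebra.ι (AddMonoidAlgebra k Λ))).prod

/-- The generic Hecke algebra `H(W, S, L)` over `A = k[Λ]`, through its standard presentation. -/
def HeckeAlgebra (M : CoxeterMatrix B) (L : B → Λ) := RingQuot (HeckeRel k M L)

namespace HeckeAlgebra

variable (M : CoxeterMatrix B) (L : B → Λ)

instance : Ring (HeckeAlgebra k M L) := inferInstanceAs (Ring (RingQuot (HeckeRel k M L)))

instance : Algebra (AddMonoidAlgebra k Λ) (HeckeAlgebra k M L) :=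
  inferInstanceAs (Algebra (AddMonoidAlgebra k Λ) (RingQuot (HeckeRel k M L)))

/-- The generator `T_s`. -/
def T (s : B) : HeckeAlgebra k M L :=
  RingQuot.mkAlgHom (AddMonoidAlgebra k Λ) (HeckeRel k M L)
    (FreeAlgebra.ι (AddMonoidAlgebra k Λ) s)

/-- The element `T_{s_1} ⋯ T_{s_n}`; it is `T_w` when `s_1 ⋯ s_n` is a reduced word of `w`. -/
def wordT (ω : List B) : HeckeAlgebra k M L := (ω.map (T k M L)).prod

/-- The element `T_s ^ (-1) = T_s - (q ^ L(s) - q ^ (-L(s)))`. -/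
def TInv (s : B) : HeckeAlgebra k M L :=
  T k M L s - algebraMap (AddMonoidAlgebra k Λ) (HeckeAlgebra k M L) (heckeParam k L s)

variable {k M L}

theorem T_mul_T (s : B) : T k M L s * T k M L s = 1 + heckeParam k L s • T k M L s := by
  have h := RingQuot.mkAlgHom_rel (AddMonoidAlgebra k Λ) (HeckeRel.quad (k := k) (M := M) (L := L) s)
  simp only [map_mul, map_add, map_one, map_smul] at h
  exact h

theorem prod_mkAlgHom (ω : List B) :
    RingQuot.mkAlgHom (AddMonoidAlgebra k Λ) (HeckeRel k M L)
      ((ω.map (FreeAlgebra.ι (AddMonoidAlgebra k Λ))).prod) = wordT k M L ω := by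
  rw [map_list_prod, List.map_map]
  rfl

theorem wordT_braid (s t : B) :
    wordT k M L (braidWord M s t) = wordT k M L (braidWord M t s) := by
  rw [← prod_mkAlgHom, ← prod_mkAlgHom]
  exact RingQuot.mkAlgHom_rel (AddMonoidAlgebra k Λ) (HeckeRel.braid s t)

theorem T_mul_TInv (s : B) : T k M L s * TInv k M L s = 1 := by
  rw [TInv, mul_sub, T_mul_T, ← Algebra.commutes, Algebra.smul_def]
  abel

theorem TInv_mul_T (s : B) : TInv k M L s * T k M L s = 1 := by
  rw [TInv, sub_mul, T_mul_T, Algebra.smul_def]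
  abel

theorem wordT_reverse_mul (ω : List B) :
    wordT k M L ω.reverse * (ω.map (TInv k M L)).prod = 1 := by
  induction ω with
  | nil => simp [wordT]
  | cons s ω ih =>
    have h : wordT k M L (s :: ω).reverse = wordT k M L ω.reverse * T k M L s := by
      simp [wordT]
    rw [h, List.map_cons, List.prod_cons, mul_assoc, ← mul_assoc (T k M L s), T_mul_TInv,
      one_mul, ih]

theorem mul_wordT_reverse (ω : List B) :
    (ω.map (TInv k M L)).prod * wordT k M L ω.reverse = 1 := by
  induction ω with
  | nil => simp [wordT]
  | cons s ω ih =>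
    have h : wordT k M L (s :: ω).reverse = wordT k M L ω.reverse * T k M L s := by
      simp [wordT]
    rw [h, List.map_cons, List.prod_cons, mul_assoc, ← mul_assoc _ (wordT k M L ω.reverse), ih,
      one_mul, TInv_mul_T]

theorem reverse_alternatingWord (i j : B) (m : ℕ) :
    (alternatingWord i j m).reverse =
      if Even m then alternatingWord j i m else alternatingWord i j m := by
  induction m generalizing i j with
  | zero => simp [alternatingWord]
  | succ m ih =>
    rw [alternatingWord_succ, List.concat_eq_append, List.reverse_append, ih]
    by_cases hm : Even m
    · have h := alternatingWord_succ' i j m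
      rw [alternatingWord_succ, List.concat_eq_append] at h
      simp [hm, parity_simps, h]
    · simp [hm, parity_simps, alternatingWord_succ']

theorem wordT_reverse_braid (s t : B) :
    wordT k M L (braidWord M s t).reverse = wordT k M L (braidWord M t s).reverse := by
  have h := wordT_braid (k := k) (M := M) (L := L) s t
  have hM := M.symmetric s t
  unfold braidWord at h ⊢
  rw [hM] at h ⊢
  rw [reverse_alternatingWord, reverse_alternatingWord]
  split_ifs
  · exact h.symm
  · exact h

theorem prod_TInv_braid (s t : B) :
    ((braidWord M s t).map (TInv k M L)).prod = ((braidWord M t s).map (TInv k M L)).prod := by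
  refine left_inv_eq_right_inv (mul_wordT_reverse (braidWord M s t)) ?_
  rw [wordT_reverse_braid, wordT_reverse_mul]

theorem TInv_mul_TInv (s : B) :
    TInv k M L s * TInv k M L s = 1 - heckeParam k L s • TInv k M L s := by
  have h : heckeParam k L s • TInv k M L s =
      (T k M L s - TInv k M L s) * TInv k M L s := by
    rw [TInv, sub_sub_cancel, Algebra.smul_def]
  rw [h, sub_mul, T_mul_TInv, sub_sub_cancel]

variable (k M L)

/-- The algebra map `Φ` over `A` with `Φ(T_s) = - T_s ^ (-1)`, i.e. `Φ(T_w) = ε_w • bar(T_w)`. -/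
def Phi : HeckeAlgebra k M L →ₐ[AddMonoidAlgebra k Λ] HeckeAlgebra k M L :=
  RingQuot.liftAlgHom (AddMonoidAlgebra k Λ)
    ⟨FreeAlgebra.lift (AddMonoidAlgebra k Λ) (fun s => -TInv k M L s), by
      have hp : ∀ ω : List B, (ω.map (fun s => -TInv k M L s)).prod =
          (-1) ^ ω.length * (ω.map (TInv k M L)).prod := by
        intro ω
        induction ω with
        | nil => simp
        | cons s ω ih =>
          rw [List.map_cons, List.prod_cons, ih, List.length_cons, pow_succ, List.map_cons,
            List.prod_cons, neg_mul, ← mul_assoc,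
            ← ((Commute.neg_one_left (TInv k M L s)).pow_left ω.length).eq]
          simp [mul_assoc]
      intro x y h
      cases h with
      | quad s =>
        simp only [map_mul, map_add, map_one, map_smul, FreeAlgebra.lift_ι_apply, neg_mul_neg,
          TInv_mul_TInv, smul_neg, sub_eq_add_neg]
      | braid s t =>
        rw [map_list_prod, map_list_prod, List.map_map, List.map_map]
        have hc : (FreeAlgebra.lift (AddMonoidAlgebra k Λ) (fun s => -TInv k M L s)) ∘
            FreeAlgebra.ι (AddMonoidAlgebra k Λ) = fun s => -TInv k M L s :=
          FreeAlgebra.ι_comp_lift _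
        rw [hc, hp, hp, prod_TInv_braid, length_alternatingWord, length_alternatingWord,
          M.symmetric s t]⟩

/-- The ring map from the free algebra that underlies the bar involution: it applies the bar
automorphism to the scalars and sends the generator `s` to `T_s ^ (-1)`. -/
def preBar : FreeAlgebra (AddMonoidAlgebra k Λ) B →+* HeckeAlgebra k M L :=
  letI : Algebra (AddMonoidAlgebra k Λ) (HeckeAlgebra k M L) :=
    ((algebraMap (AddMonoidAlgebra k Λ) (HeckeAlgebra k M L)).comp (barA k Λ)).toAlgebra'
      fun c x => Algebra.commutes (barA k Λ c) x
  (FreeAlgebra.lift (AddMonoidAlgebra k Λ) (TInv k M L)).toRingHom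

theorem preBar_ι (s : B) :
    preBar k M L (FreeAlgebra.ι (AddMonoidAlgebra k Λ) s) = TInv k M L s := by
  let : Algebra (AddMonoidAlgebra k Λ) (HeckeAlgebra k M L) :=
    ((algebraMap (AddMonoidAlgebra k Λ) (HeckeAlgebra k M L)).comp (barA k Λ)).toAlgebra'
      fun c x => Algebra.commutes (barA k Λ c) x
  exact FreeAlgebra.lift_ι_apply (R := AddMonoidAlgebra k Λ) (TInv k M L) s

theorem preBar_algebraMap (a : AddMonoidAlgebra k Λ) :
    preBar k M L (algebraMap _ _ a) = algebraMap _ _ (barA k Λ a) := by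
  let inst : Algebra (AddMonoidAlgebra k Λ) (HeckeAlgebra k M L) :=
    ((algebraMap (AddMonoidAlgebra k Λ) (HeckeAlgebra k M L)).comp (barA k Λ)).toAlgebra'
      fun c x => Algebra.commutes (barA k Λ c) x
  exact AlgHom.commutes (@FreeAlgebra.lift (AddMonoidAlgebra k Λ) B _ (HeckeAlgebra k M L) _ inst
    (TInv k M L)) a

/-- The bar involution of `H`: the ring map with `q ^ γ ↦ q ^ (-γ)` and `T_s ↦ T_s ^ (-1)`. -/
def bar : HeckeAlgebra k M L →+* HeckeAlgebra k M L :=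
  RingQuot.lift ⟨preBar k M L, by
    intro x y h
    cases h with
    | quad s =>
      have hb : barA k Λ (heckeParam k L s) = -heckeParam k L s := by
        simp [heckeParam, barA_qpow]
      rw [Algebra.smul_def, map_add, map_mul, map_mul, map_one, preBar_algebraMap, preBar_ι, hb,
        TInv_mul_TInv, map_neg, neg_mul, ← Algebra.smul_def, sub_eq_add_neg]
    | braid s t =>
      have hc : (preBar k M L) ∘ FreeAlgebra.ι (AddMonoidAlgebra k Λ) = TInv k M L :=
        funext (preBar_ι k M L)
      rw [map_list_prod, map_list_prod, List.map_map, List.map_map, hc, prod_TInv_braid]⟩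

theorem Phi_T (s : B) : Phi k M L (T k M L s) = -TInv k M L s := by
  unfold Phi T
  erw [RingQuot.liftAlgHom_mkAlgHom_apply]
  exact FreeAlgebra.lift_ι_apply _ _

theorem bar_mk (x : FreeAlgebra (AddMonoidAlgebra k Λ) B) :
    bar k M L (RingQuot.mkAlgHom (AddMonoidAlgebra k Λ) (HeckeRel k M L) x) = preBar k M L x := by
  have h : RingQuot.mkAlgHom (AddMonoidAlgebra k Λ) (HeckeRel k M L) x =
      RingQuot.mkRingHom (HeckeRel k M L) x :=
    RingHom.congr_fun (RingQuot.mkAlgHom_coe (AddMonoidAlgebra k Λ) (HeckeRel k M L)) x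
  rw [h]
  exact RingQuot.lift_mkRingHom_apply _ _ _

theorem bar_T (s : B) : bar k M L (T k M L s) = TInv k M L s := by
  rw [← preBar_ι]
  exact bar_mk k M L _

theorem bar_algebraMap (a : AddMonoidAlgebra k Λ) :
    bar k M L (algebraMap _ _ a) = algebraMap _ _ (barA k Λ a) := by
  rw [← preBar_algebraMap, ← bar_mk, AlgHom.commutes]
  rfl

/-- `Φ(T_w) = ε_w • bar(T_w)`: apply this to a reduced word of `w`. -/
theorem Phi_wordT (ω : List B) :
    Phi k M L (wordT k M L ω) = (-1) ^ ω.length * bar k M L (wordT k M L ω) := by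
  induction ω with
  | nil => simp [wordT]
  | cons s ω ih =>
    have h : wordT k M L (s :: ω) = T k M L s * wordT k M L ω := by simp [wordT]
    rw [h, map_mul, map_mul, ih, Phi_T, bar_T, List.length_cons, pow_succ, neg_mul,
      ← mul_assoc, ← ((Commute.neg_one_left (TInv k M L s)).pow_left ω.length).eq]
    simp [mul_assoc]

/-- The bar involution sends `T_w` to the inverse of `T_{w⁻¹}`. -/
theorem wordT_reverse_mul_bar (ω : List B) :
    wordT k M L ω.reverse * bar k M L (wordT k M L ω) = 1 := by
  have h : bar k M L (wordT k M L ω) = (ω.map (TInv k M L)).prod := by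
    rw [wordT, map_list_prod, List.map_map]
    congr 2
    exact funext (bar_T k M L)
  rw [h, wordT_reverse_mul]

end HeckeAlgebra

end Hecke

/-! ## Orders on a Coxeter group and W-graph ideals -/

section Ideals

variable {B W : Type*} [Group W] {M : CoxeterMatrix B} (cs : CoxeterSystem M W)

/-- The Bruhat order: `u ≤ v` if `v` is reached from `u` by multiplications by reflections, each
of which increases the length. -/
def BruhatLE : W → W → Prop :=
  Relation.ReflTransGen fun u v => ∃ t, cs.IsReflection t ∧ v = u * t ∧ cs.length u < cs.length v

/-- The strict Bruhat order. -/
def BruhatLT (u v : W) : Prop := BruhatLE cs u v ∧ u ≠ v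

/-- The left weak order: `x` is a suffix of `y`. -/
def LeftWeakLE (x y : W) : Prop := ∃ z, y = z * x ∧ cs.length y = cs.length z + cs.length x

/-- `Pos(X)`, the set of the `s` with `ℓ(xs) > ℓ(x)` for all `x ∈ X`. -/
def PosSet (X : Set W) : Set B := {s | ∀ x ∈ X, cs.length x < cs.length (x * cs.simple s)}

/-- `D_J`, the set of minimal coset representatives. -/
def minReps (J : Set B) : Set W := {w | ∀ s ∈ J, cs.length w < cs.length (w * cs.simple s)}

/-- `E` is a (non-empty) ideal of the left weak order, and `J ⊆ Pos(E)`. -/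
structure IsIdealFor (J : Set B) (E : Set W) : Prop where
  nonempty : E.Nonempty
  suffix_mem : ∀ u w, w ∈ E → LeftWeakLE cs u w → u ∈ E
  subset_pos : J ⊆ PosSet cs E

variable {cs} in
theorem IsIdealFor.one_mem {J : Set B} {E : Set W} (h : IsIdealFor cs J E) : (1 : W) ∈ E := by
  obtain ⟨w, hw⟩ := h.nonempty
  exact h.suffix_mem 1 w hw ⟨w, by simp, by simp⟩

/-- `E_{J,s}^-`. -/
def EMinus (E : Set W) (s : B) : Set W :=
  {w | w ∈ E ∧ cs.length (cs.simple s * w) < cs.length w ∧ cs.simple s * w ∈ E}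

/-- `E_{J,s}^+`. -/
def EPlus (E : Set W) (s : B) : Set W :=
  {w | w ∈ E ∧ cs.length w < cs.length (cs.simple s * w) ∧ cs.simple s * w ∈ E}

/-- `E_{J,s}^{0,-}`. -/
def EZeroMinus (J : Set B) (E : Set W) (s : B) : Set W :=
  {w | w ∈ E ∧ cs.length w < cs.length (cs.simple s * w) ∧ cs.simple s * w ∉ minReps cs J}

/-- `E_{J,s}^{0,+}`. -/
def EZeroPlus (J : Set B) (E : Set W) (s : B) : Set W :=
  {w | w ∈ E ∧ cs.length w < cs.length (cs.simple s * w) ∧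
    cs.simple s * w ∈ minReps cs J \ E}

variable {k : Type*} [CommRing k] {Λ : Type*} [AddCommGroup Λ] [LinearOrder Λ]

/-- The module `V` with the `A`-basis `Γ_w = b w` (`w ∈ E`), the polynomials `r^s_{z,w} = r s z w`
and the semilinear map `bar` is a module `M(E_J, L)` as required of a W-graph ideal `E_J`.
(The sums are finite since lower intervals of the Bruhat order are finite; the values of `r s z w`
matter only for `w ∈ E_{J,s}^{0,+}` and `z < w`.) -/
structure IsWGraphIdealModule (L : B → Λ) {J : Set B} {E : Set W} (hE : IsIdealFor cs J E)
    {V : Type*} [AddCommGroup V] [Module (AddMonoidAlgebra k Λ) V]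
    [Module (HeckeAlgebra k M L) V]
    [IsScalarTower (AddMonoidAlgebra k Λ) (HeckeAlgebra k M L) V]
    (b : Module.Basis E (AddMonoidAlgebra k Λ) V) (r : B → E → E → AddMonoidAlgebra k Λ)
    (bar : V →ₛₗ[barA k Λ] V) : Prop where
  T_smul_minus : ∀ (s : B) (w : W) (h : w ∈ EMinus cs E s),
    HeckeAlgebra.T k M L s • b ⟨w, h.1⟩ =
      b ⟨cs.simple s * w, h.2.2⟩ + (qpow k (L s) - qpow k (-(L s))) • b ⟨w, h.1⟩
  T_smul_plus : ∀ (s : B) (w : W) (h : w ∈ EPlus cs E s),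
    HeckeAlgebra.T k M L s • b ⟨w, h.1⟩ = b ⟨cs.simple s * w, h.2.2⟩
  T_smul_zero_minus : ∀ (s : B) (w : W) (h : w ∈ EZeroMinus cs J E s),
    HeckeAlgebra.T k M L s • b ⟨w, h.1⟩ = -qpow k (-(L s)) • b ⟨w, h.1⟩
  T_smul_zero_plus : ∀ (s : B) (w : W) (h : w ∈ EZeroPlus cs J E s),
    HeckeAlgebra.T k M L s • b ⟨w, h.1⟩ =
      qpow k (L s) • b ⟨w, h.1⟩ - ∑ᶠ (z : E) (_ : BruhatLT cs z w), r s z ⟨w, h.1⟩ • b z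
  r_mem : ∀ (s : B) (w : W) (h : w ∈ EZeroPlus cs J E s) (z : E), BruhatLT cs z w →
    ∃ a, IsPosPart a ∧ r s z ⟨w, h.1⟩ = qpow k (L s) * a
  bar_bar : ∀ α, bar (bar α) = α
  bar_one : bar (b ⟨1, hE.one_mem⟩) = b ⟨1, hE.one_mem⟩
  bar_smul : ∀ (h : HeckeAlgebra k M L) (α : V), bar (h • α) = HeckeAlgebra.bar k M L h • bar α

/-- The dual set-up: `V` with the `A`-basis `b w` (`w ∈ E`), the polynomials `r s z w` and the
semilinear map `bar` is a dual module. -/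
structure IsDualWGraphIdealModule (L : B → Λ) {J : Set B} {E : Set W} (hE : IsIdealFor cs J E)
    {V : Type*} [AddCommGroup V] [Module (AddMonoidAlgebra k Λ) V]
    [Module (HeckeAlgebra k M L) V]
    [IsScalarTower (AddMonoidAlgebra k Λ) (HeckeAlgebra k M L) V]
    (b : Module.Basis E (AddMonoidAlgebra k Λ) V) (r : B → E → E → AddMonoidAlgebra k Λ)
    (bar : V →ₛₗ[barA k Λ] V) : Prop where
  T_smul_minus : ∀ (s : B) (w : W) (h : w ∈ EMinus cs E s),
    HeckeAlgebra.T k M L s • b ⟨w, h.1⟩ =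
      b ⟨cs.simple s * w, h.2.2⟩ + (qpow k (L s) - qpow k (-(L s))) • b ⟨w, h.1⟩
  T_smul_plus : ∀ (s : B) (w : W) (h : w ∈ EPlus cs E s),
    HeckeAlgebra.T k M L s • b ⟨w, h.1⟩ = b ⟨cs.simple s * w, h.2.2⟩
  T_smul_zero_minus : ∀ (s : B) (w : W) (h : w ∈ EZeroMinus cs J E s),
    HeckeAlgebra.T k M L s • b ⟨w, h.1⟩ = qpow k (L s) • b ⟨w, h.1⟩
  T_smul_zero_plus : ∀ (s : B) (w : W) (h : w ∈ EZeroPlus cs J E s),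
    HeckeAlgebra.T k M L s • b ⟨w, h.1⟩ =
      -qpow k (-(L s)) • b ⟨w, h.1⟩ + ∑ᶠ (z : E) (_ : BruhatLT cs z w), r s z ⟨w, h.1⟩ • b z
  r_mem : ∀ (s : B) (w : W) (h : w ∈ EZeroPlus cs J E s) (z : E), BruhatLT cs z w →
    ∃ a, IsNegPart a ∧ r s z ⟨w, h.1⟩ = qpow k (-(L s)) * a
  bar_bar : ∀ α, bar (bar α) = α
  bar_one : bar (b ⟨1, hE.one_mem⟩) = b ⟨1, hE.one_mem⟩
  bar_smul : ∀ (h : HeckeAlgebra k M L) (α : V), bar (h • α) = HeckeAlgebra.bar k M L h • bar α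

/-- The dual polynomials `ε_z ε_w bar(r^s_{z,w})`, where `ε_w = (-1) ^ ℓ(w)`. -/
def dualCoeff {E : Set W} (r : B → E → E → AddMonoidAlgebra k Λ) :
    B → E → E → AddMonoidAlgebra k Λ :=
  fun s z w => (-1) ^ cs.length (z : W) * (-1) ^ cs.length (w : W) * barA k Λ (r s z w)

end Ideals

/-- `E` is a W-graph ideal with respect to `J` and `L`: it is an ideal of the left weak order,
`J ⊆ Pos(E)`, and a module `M(E_J, L)` exists. -/
def IsWGraphIdeal (k : Type*) [CommRing k] {B W : Type*} [Group W] {M : CoxeterMatrix B}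
    (cs : CoxeterSystem M W) {Λ : Type*} [AddCommGroup Λ] [LinearOrder Λ] (L : B → Λ)
    (J : Set B) (E : Set W) : Prop :=
  ∃ hE : IsIdealFor cs J E, ∃ (V : Type v) (_ : AddCommGroup V)
    (_ : Module (AddMonoidAlgebra k Λ) V) (_ : Module (HeckeAlgebra k M L) V)
    (_ : IsScalarTower (AddMonoidAlgebra k Λ) (HeckeAlgebra k M L) V)
    (b : Module.Basis E (AddMonoidAlgebra k Λ) V) (r : B → E → E → AddMonoidAlgebra k Λ)
    (bar : V →ₛₗ[barA k Λ] V), IsWGraphIdealModule cs L hE b r bar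

end

/-!
The dual module is `M` itself with the Hecke algebra acting through `Φ` (`PhiTwist`), with the basis
`ε_w • bar Γ_w` (`dualBasis`) and the same bar involution. Since `bar (T_s α) = T_s⁻¹ (bar α)`, the
generator acts by `T_s • (ε_w • bar Γ_w) = -ε_w • bar (T_s Γ_w)`, and applying `-ε_w bar` to the four
formulas for `T_s Γ_w` gives the four formulas for the dual module
(`IsWGraphIdealModule.isDual_phiTwist`). This uses that `Φ` and `bar` commute.

The action of `T_s` on a dual module is determined by the coefficients, as the four cases exhaust
the ideal. So the linear map between two dual modules that matches the bases is an isomorphism of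
Hecke modules (`IsDualWGraphIdealModule.equiv_smul`), and `η` is this isomorphism from the twisted
`M` to the given dual module. It is unique since `Γ_1` generates `M` over the Hecke algebra
(`IsWGraphIdealModule.exists_smul_one`). It commutes with the bar involutions because
`bar ∘ η ∘ bar` has the properties that characterize `η`. The inverse of `η` is again `Φ`-semilinear
because `Φ` is an involution.
-/

noncomputable section

open CoxeterSystem

/-! ### The bar automorphism of the coefficient ring -/

section Coefficients

variable {k : Type*} [CommRing k] {Λ : Type*} [AddCommGroup Λ]

theorem barA_barA (a : AddMonoidAlgebra k Λ) : barA k Λ (barA k Λ a) = a := by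
  induction a using AddMonoidAlgebra.induction_linear with
  | zero => simp
  | add f g hf hg => rw [map_add, map_add, hf, hg]
  | single γ c => simp [barA]

theorem barA_heckeParam {B : Type*} (L : B → Λ) (s : B) :
    barA k Λ (heckeParam k L s) = -heckeParam k L s := by
  simp [heckeParam, barA_qpow]

theorem IsPosPart.barA [LinearOrder Λ] [IsOrderedAddMonoid Λ] {a : AddMonoidAlgebra k Λ}
    (ha : IsPosPart a) : IsNegPart (barA k Λ a) := by
  classical
  intro γ hγ
  obtain ⟨δ, hδ, rfl⟩ := Finset.mem_image.1 (Finsupp.mapDomain_support hγ)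
  exact neg_lt_zero.2 (ha δ hδ)

end Coefficients

/-! ### The involutions of the Hecke algebra -/

namespace HeckeAlgebra

variable {k : Type*} [CommRing k] {B : Type*} {Λ : Type*} [AddCommGroup Λ]
  {M : CoxeterMatrix B} {L : B → Λ}

@[elab_as_elim]
theorem induction {p : HeckeAlgebra k M L → Prop}
    (algebraMap : ∀ a, p (algebraMap (AddMonoidAlgebra k Λ) (HeckeAlgebra k M L) a))
    (T : ∀ s, p (T k M L s)) (mul : ∀ x y, p x → p y → p (x * y))
    (add : ∀ x y, p x → p y → p (x + y)) (h : HeckeAlgebra k M L) : p h := by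
  obtain ⟨x, rfl⟩ := RingQuot.mkAlgHom_surjective (AddMonoidAlgebra k Λ) (HeckeRel k M L) h
  induction x using FreeAlgebra.induction with
  | grade0 a => rw [AlgHom.commutes]; exact algebraMap a
  | grade1 s => exact T s
  | mul x y hx hy => rw [map_mul]; exact mul _ _ hx hy
  | add x y hx hy => rw [map_add]; exact add _ _ hx hy

theorem Phi_TInv (s : B) : Phi k M L (TInv k M L s) = -T k M L s := by
  rw [TInv, map_sub, Phi_T, AlgHom.commutes, TInv]
  abel

theorem bar_TInv (s : B) : bar k M L (TInv k M L s) = T k M L s := by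
  rw [TInv, map_sub, bar_T, bar_algebraMap, barA_heckeParam, map_neg, TInv]
  abel

theorem Phi_Phi (h : HeckeAlgebra k M L) : Phi k M L (Phi k M L h) = h := by
  induction h using HeckeAlgebra.induction with
  | algebraMap a => rw [AlgHom.commutes, AlgHom.commutes]
  | T s => rw [Phi_T, map_neg, Phi_TInv, neg_neg]
  | mul x y hx hy => rw [map_mul, map_mul, hx, hy]
  | add x y hx hy => rw [map_add, map_add, hx, hy]

theorem bar_bar (h : HeckeAlgebra k M L) : bar k M L (bar k M L h) = h := by
  induction h using HeckeAlgebra.induction with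
  | algebraMap a => rw [bar_algebraMap, bar_algebraMap, barA_barA]
  | T s => rw [bar_T, bar_TInv]
  | mul x y hx hy => rw [map_mul, map_mul, hx, hy]
  | add x y hx hy => rw [map_add, map_add, hx, hy]

theorem bar_Phi (h : HeckeAlgebra k M L) :
    bar k M L (Phi k M L h) = Phi k M L (bar k M L h) := by
  induction h using HeckeAlgebra.induction with
  | algebraMap a => rw [AlgHom.commutes, bar_algebraMap, AlgHom.commutes]
  | T s => rw [Phi_T, bar_T, map_neg, bar_TInv, Phi_TInv]
  | mul x y hx hy => rw [map_mul, map_mul, map_mul, map_mul, hx, hy]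
  | add x y hx hy => rw [map_add, map_add, map_add, map_add, hx, hy]

variable {V V' : Type*} [AddCommGroup V] [Module (AddMonoidAlgebra k Λ) V]
  [Module (HeckeAlgebra k M L) V] [IsScalarTower (AddMonoidAlgebra k Λ) (HeckeAlgebra k M L) V]
  [AddCommGroup V'] [Module (AddMonoidAlgebra k Λ) V']
  [Module (HeckeAlgebra k M L) V'] [IsScalarTower (AddMonoidAlgebra k Λ) (HeckeAlgebra k M L) V']

theorem T_smul_smul (s : B) (a : AddMonoidAlgebra k Λ) (α : V) :
    T k M L s • a • α = a • T k M L s • α := by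
  rw [← algebraMap_smul (HeckeAlgebra k M L) a α, ← mul_smul, ← Algebra.commutes, mul_smul,
    algebraMap_smul]

/-- A map linear over the coefficients is linear over the Hecke algebra as soon as it commutes with
the generators on a basis. -/
theorem map_smul_of_basis {ι : Type*} (b : Module.Basis ι (AddMonoidAlgebra k Λ) V)
    (f : V →ₗ[AddMonoidAlgebra k Λ] V')
    (hf : ∀ s i, f (T k M L s • b i) = T k M L s • f (b i))
    (h : HeckeAlgebra k M L) (α : V) : f (h • α) = h • f α := by
  induction h using HeckeAlgebra.induction generalizing α with
  | algebraMap a => rw [algebraMap_smul, algebraMap_smul, map_smul]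
  | T s =>
    induction b.mem_span α using Submodule.span_induction with
    | mem x hx => obtain ⟨i, rfl⟩ := hx; exact hf s i
    | zero => simp
    | add x y _ _ hx hy => simp only [smul_add, map_add, hx, hy]
    | smul a x _ hx => rw [T_smul_smul, f.map_smul, f.map_smul, T_smul_smul, hx]
  | mul x y hx hy => rw [mul_smul, mul_smul, hx, hy]
  | add x y hx hy => rw [add_smul, add_smul, map_add, hx, hy]

end HeckeAlgebra

/-! ### The twist of a module by `Φ` -/

/-- The module `V` over the Hecke algebra, with `h` acting as `Φ(h)` acts on `V`. The action of the
coefficient ring is unchanged. -/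
def PhiTwist (k : Type*) [CommRing k] {B : Type*} {Λ : Type*} [AddCommGroup Λ]
    (_ : CoxeterMatrix B) (_ : B → Λ) (V : Type*) : Type _ := V

namespace PhiTwist

variable (k : Type*) [CommRing k] {B : Type*} {Λ : Type*} [AddCommGroup Λ]
  (M : CoxeterMatrix B) (L : B → Λ) {V : Type*} [AddCommGroup V] [Module (AddMonoidAlgebra k Λ) V]

instance : AddCommGroup (PhiTwist k M L V) := inferInstanceAs (AddCommGroup V)

instance : Module (AddMonoidAlgebra k Λ) (PhiTwist k M L V) :=
  inferInstanceAs (Module (AddMonoidAlgebra k Λ) V)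

variable (V) in
/-- The identity map from `V` to its twist. -/
def of : V ≃ₗ[AddMonoidAlgebra k Λ] PhiTwist k M L V := LinearEquiv.refl _ _

variable {k M L}

/-- A bar-semilinear map on `V`, regarded as a map on the twist. -/
def barMap (bar : V →ₛₗ[barA k Λ] V) : PhiTwist k M L V →ₛₗ[barA k Λ] PhiTwist k M L V where
  toFun α := of k M L V (bar ((of k M L V).symm α))
  map_add' := by simp
  map_smul' := by simp

theorem barMap_of (bar : V →ₛₗ[barA k Λ] V) (α : V) :
    barMap (M := M) (L := L) bar (of k M L V α) = of k M L V (bar α) := rfl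

variable [Module (HeckeAlgebra k M L) V]

instance : Module (HeckeAlgebra k M L) (PhiTwist k M L V) :=
  Module.compHom V (HeckeAlgebra.Phi k M L).toRingHom

theorem smul_of (h : HeckeAlgebra k M L) (α : V) :
    h • of k M L V α = of k M L V (HeckeAlgebra.Phi k M L h • α) := rfl

theorem of_smul (h : HeckeAlgebra k M L) (α : V) :
    of k M L V (h • α) = HeckeAlgebra.Phi k M L h • of k M L V α := by
  rw [smul_of, HeckeAlgebra.Phi_Phi]

instance [IsScalarTower (AddMonoidAlgebra k Λ) (HeckeAlgebra k M L) V] :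
    IsScalarTower (AddMonoidAlgebra k Λ) (HeckeAlgebra k M L) (PhiTwist k M L V) where
  smul_assoc a h α := by
    obtain ⟨α, rfl⟩ := (of k M L V).surjective α
    rw [smul_of, smul_of, AlgHom.map_smul_of_tower, smul_assoc, LinearEquiv.map_smul]

end PhiTwist

/-! ### Existence of the dual module -/

section Dual

variable {k : Type*} [CommRing k] {Λ : Type*} [AddCommGroup Λ]

/-- The image of a basis under a bar-semilinear involution. -/
def Module.Basis.mapBar {V ι : Type*} [AddCommGroup V] [Module (AddMonoidAlgebra k Λ) V]
    (b : Module.Basis ι (AddMonoidAlgebra k Λ) V) (bar : V →ₛₗ[barA k Λ] V)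
    (hbar : ∀ α, bar (bar α) = α) : Module.Basis ι (AddMonoidAlgebra k Λ) V :=
  Module.Basis.ofRepr
    { toFun := fun α => (b.repr (bar α)).mapRange (barA k Λ) (map_zero _)
      invFun := fun x => bar (b.repr.symm (x.mapRange (barA k Λ) (map_zero _)))
      left_inv := fun α => by
        have h : ((b.repr (bar α)).mapRange (barA k Λ) (map_zero _)).mapRange (barA k Λ)
            (map_zero _) = b.repr (bar α) := by ext1 i; simp [barA_barA]
        simp only [h, LinearEquiv.symm_apply_apply, hbar]
      right_inv := fun x => by ext1 i; simp [hbar, barA_barA]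
      map_add' := fun α β => by ext1 i; simp
      map_smul' := fun a α => by ext1 i; simp [barA_barA] }

theorem Module.Basis.mapBar_apply {V ι : Type*} [AddCommGroup V] [Module (AddMonoidAlgebra k Λ) V]
    (b : Module.Basis ι (AddMonoidAlgebra k Λ) V) (bar : V →ₛₗ[barA k Λ] V)
    (hbar : ∀ α, bar (bar α) = α) (i : ι) : b.mapBar bar hbar i = bar (b i) := by
  rw [Module.Basis.apply_eq_iff]
  ext1 j
  simp [Module.Basis.mapBar, hbar]

variable {B W : Type*} [Group W] {M : CoxeterMatrix B} (cs : CoxeterSystem M W) {L : B → Λ}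
  {J : Set B} {E : Set W} {V : Type*} [AddCommGroup V] [Module (AddMonoidAlgebra k Λ) V]

theorem neg_one_pow_length_simple_mul (A : Type*) [Ring A] (s : B) (w : W) :
    (-1 : A) ^ cs.length (cs.simple s * w) = -(-1) ^ cs.length w := by
  rcases cs.length_simple_mul w s with h | h
  · rw [h, pow_succ, mul_neg_one]
  · rw [← h, pow_succ, mul_neg_one, neg_neg]

/-- The basis `ε_w • bar Γ_w` of the twist of `V`, where `Γ_w = b w`. -/
def dualBasis (b : Module.Basis E (AddMonoidAlgebra k Λ) V) (bar : V →ₛₗ[barA k Λ] V)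
    (hbar : ∀ α, bar (bar α) = α) :
    Module.Basis E (AddMonoidAlgebra k Λ) (PhiTwist k M L V) :=
  ((b.mapBar bar hbar).unitsSMul fun w => (-1) ^ cs.length (w : W)).map (PhiTwist.of k M L V)

theorem dualBasis_apply (b : Module.Basis E (AddMonoidAlgebra k Λ) V) (bar : V →ₛₗ[barA k Λ] V)
    (hbar : ∀ α, bar (bar α) = α) (w : E) :
    dualBasis cs (L := L) b bar hbar w =
      PhiTwist.of k M L V ((-1 : AddMonoidAlgebra k Λ) ^ cs.length (w : W) • bar (b w)) := by
  rw [dualBasis, Module.Basis.map_apply, Module.Basis.unitsSMul_apply, Module.Basis.mapBar_apply,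
    Units.smul_def]
  simp

variable {cs} [LinearOrder Λ] [Module (HeckeAlgebra k M L) V]
  [IsScalarTower (AddMonoidAlgebra k Λ) (HeckeAlgebra k M L) V]
  {hE : IsIdealFor cs J E} {b : Module.Basis E (AddMonoidAlgebra k Λ) V}
  {r : B → E → E → AddMonoidAlgebra k Λ} {bar : V →ₛₗ[barA k Λ] V}

/-- `T_s • Γ̃_w = -ε_w • bar (T_s Γ_w)`, since `Φ(T_s) = -bar T_s`. -/
theorem IsWGraphIdealModule.T_smul_dualBasis (hV : IsWGraphIdealModule cs L hE b r bar) (s : B)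
    (w : E) : HeckeAlgebra.T k M L s • dualBasis cs (L := L) b bar hV.bar_bar w =
      PhiTwist.of k M L V (-((-1 : AddMonoidAlgebra k Λ) ^ cs.length (w : W) •
        bar (HeckeAlgebra.T k M L s • b w))) := by
  rw [dualBasis_apply, PhiTwist.smul_of, HeckeAlgebra.Phi_T, hV.bar_smul, HeckeAlgebra.bar_T,
    neg_smul, HeckeAlgebra.TInv, sub_smul, sub_smul, HeckeAlgebra.T_smul_smul, algebraMap_smul,
    algebraMap_smul, smul_sub, smul_comm (heckeParam k L s)]

/-- The twist of `V` by `Φ`, with the basis `ε_w • bar Γ_w`, is a dual module. -/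
theorem IsWGraphIdealModule.isDual_phiTwist [IsOrderedAddMonoid Λ]
    (hV : IsWGraphIdealModule cs L hE b r bar) :
    IsDualWGraphIdealModule cs L hE (dualBasis cs (L := L) b bar hV.bar_bar) (dualCoeff cs r)
      (PhiTwist.barMap bar) where
  T_smul_minus s w h := by
    rw [hV.T_smul_dualBasis, hV.T_smul_minus s w h, dualBasis_apply, dualBasis_apply,
      ← LinearEquiv.map_smul, ← map_add]
    congr 1
    simp only [map_add, map_sub, LinearMap.map_smulₛₗ, barA_qpow, neg_neg,
      neg_one_pow_length_simple_mul]
    module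
  T_smul_plus s w h := by
    rw [hV.T_smul_dualBasis, hV.T_smul_plus s w h, dualBasis_apply]
    congr 1
    simp only [neg_one_pow_length_simple_mul, neg_smul]
  T_smul_zero_minus s w h := by
    rw [hV.T_smul_dualBasis, hV.T_smul_zero_minus s w h, dualBasis_apply, ← LinearEquiv.map_smul]
    congr 1
    simp only [map_neg, LinearMap.map_smulₛₗ, barA_qpow, neg_neg]
    module
  T_smul_zero_plus s w h := by
    -- `ε_w • bar`, with values in the twist, as an additive equivalence: it commutes with sums
    -- over arbitrary families, without a finiteness condition.
    let e : V ≃+ PhiTwist k M L V :=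
      { toFun := fun α => PhiTwist.of k M L V
          ((-1 : AddMonoidAlgebra k Λ) ^ cs.length w • bar α)
        invFun := fun α => bar ((-1 : AddMonoidAlgebra k Λ) ^ cs.length w •
          (PhiTwist.of k M L V).symm α)
        left_inv := fun α => by
          simp [smul_smul, ← mul_pow, hV.bar_bar]
        right_inv := fun α => by
          simp [smul_smul, ← mul_pow, hV.bar_bar]
        map_add' := fun α β => by simp }
    have e_apply : ∀ α, e α = PhiTwist.of k M L V
        ((-1 : AddMonoidAlgebra k Λ) ^ cs.length w • bar α) := fun _ => rfl
    have he : ∀ z : E, e (r s z ⟨w, h.1⟩ • b z) =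
        dualCoeff cs r s z ⟨w, h.1⟩ • dualBasis cs (L := L) b bar hV.bar_bar z := by
      intro z
      rw [dualBasis_apply, ← LinearEquiv.map_smul, e_apply]
      congr 1
      have hz : (-1 : AddMonoidAlgebra k Λ) ^ cs.length (z : W) * (-1) ^ cs.length (z : W) = 1 := by
        rw [← mul_pow]; simp
      rw [LinearMap.map_smulₛₗ, smul_smul, smul_smul, dualCoeff]
      congr 1
      linear_combination -((-1) ^ cs.length w * barA k Λ (r s z ⟨w, h.1⟩)) * hz
    have hsum : e (∑ᶠ (z : E) (_ : BruhatLT cs z w), r s z ⟨w, h.1⟩ • b z) =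
        ∑ᶠ (z : E) (_ : BruhatLT cs z w), dualCoeff cs r s z ⟨w, h.1⟩ •
          dualBasis cs (L := L) b bar hV.bar_bar z := by
      simp only [AddEquiv.map_finsum, he]
    rw [hV.T_smul_dualBasis, hV.T_smul_zero_plus s w h, ← hsum, dualBasis_apply,
      ← LinearEquiv.map_smul, e_apply, ← map_add]
    congr 1
    simp only [map_sub, LinearMap.map_smulₛₗ, barA_qpow]
    module
  r_mem s w h z hz := by
    obtain ⟨a, ha, hr⟩ := hV.r_mem s w h z hz
    refine ⟨(-1) ^ cs.length (z : W) * (-1) ^ cs.length w * barA k Λ a, ?_, ?_⟩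
    · rw [← pow_add]
      rcases neg_one_pow_eq_or (AddMonoidAlgebra k Λ) (cs.length (z : W) + cs.length w) with h | h
      · rw [h, one_mul]
        exact ha.barA
      · intro γ hγ
        rw [h, neg_one_mul] at hγ
        exact ha.barA γ (by simpa using hγ)
    · simp only [dualCoeff, hr, map_mul, barA_qpow]
      ring
  bar_bar α := by
    obtain ⟨α, rfl⟩ := (PhiTwist.of k M L V).surjective α
    rw [PhiTwist.barMap_of, PhiTwist.barMap_of, hV.bar_bar]
  bar_one := by
    rw [dualBasis_apply, PhiTwist.barMap_of]
    simp [hV.bar_one]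
  bar_smul h α := by
    obtain ⟨α, rfl⟩ := (PhiTwist.of k M L V).surjective α
    rw [PhiTwist.smul_of, PhiTwist.barMap_of, PhiTwist.barMap_of, hV.bar_smul, PhiTwist.smul_of,
      HeckeAlgebra.bar_Phi]

end Dual

/-! ### Uniqueness of the dual module -/

section Uniqueness

variable {k : Type*} [CommRing k] {Λ : Type*} [AddCommGroup Λ] [LinearOrder Λ]
  {B W : Type*} [Group W] {M : CoxeterMatrix B} {cs : CoxeterSystem M W} {L : B → Λ}
  {J : Set B} {E : Set W} {hE : IsIdealFor cs J E}
  {V : Type*} [AddCommGroup V] [Module (AddMonoidAlgebra k Λ) V] [Module (HeckeAlgebra k M L) V]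
  [IsScalarTower (AddMonoidAlgebra k Λ) (HeckeAlgebra k M L) V]
  {V' : Type*} [AddCommGroup V'] [Module (AddMonoidAlgebra k Λ) V']
  [Module (HeckeAlgebra k M L) V'] [IsScalarTower (AddMonoidAlgebra k Λ) (HeckeAlgebra k M L) V']
  {b : Module.Basis E (AddMonoidAlgebra k Λ) V} {b' : Module.Basis E (AddMonoidAlgebra k Λ) V'}
  {r : B → E → E → AddMonoidAlgebra k Λ} {bar : V →ₛₗ[barA k Λ] V} {bar' : V' →ₛₗ[barA k Λ] V'}

theorem IsIdealFor.simple_mul_mem (hE : IsIdealFor cs J E) {s : B} {w : W} (hw : w ∈ E)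
    (h : cs.length (cs.simple s * w) < cs.length w) : cs.simple s * w ∈ E := by
  refine hE.suffix_mem _ w hw ⟨cs.simple s, by simp, ?_⟩
  have := cs.length_simple_mul w s
  rw [cs.length_simple]
  lia

theorem IsIdealFor.mem_cases (hE : IsIdealFor cs J E) (s : B) {w : W} (hw : w ∈ E) :
    w ∈ EMinus cs E s ∨ w ∈ EPlus cs E s ∨ w ∈ EZeroMinus cs J E s ∨ w ∈ EZeroPlus cs J E s := by
  rcases (cs.length_simple_mul_ne w s).lt_or_gt with h | h
  · exact Or.inl ⟨hw, h, hE.simple_mul_mem hw h⟩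
  · by_cases hs : cs.simple s * w ∈ E
    · exact Or.inr (Or.inl ⟨hw, h, hs⟩)
    · by_cases hJ : cs.simple s * w ∈ minReps cs J
      · exact Or.inr (Or.inr (Or.inr ⟨hw, h, hJ, hs⟩))
      · exact Or.inr (Or.inr (Or.inl ⟨hw, h, hJ⟩))

/-- Matching the bases of two dual modules with the same coefficients gives an isomorphism of
modules over the Hecke algebra. -/
theorem IsDualWGraphIdealModule.equiv_smul (hV : IsDualWGraphIdealModule cs L hE b r bar)
    (hV' : IsDualWGraphIdealModule cs L hE b' r bar') (h : HeckeAlgebra k M L) (α : V) :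
    b.equiv b' (Equiv.refl E) (h • α) = h • b.equiv b' (Equiv.refl E) α := by
  refine HeckeAlgebra.map_smul_of_basis b (b.equiv b' (Equiv.refl E)).toLinearMap ?_ h α
  rintro s ⟨w, hw⟩
  have hb : ∀ w, b.equiv b' (Equiv.refl E) (b w) = b' w := fun w => by simp
  simp only [LinearEquiv.coe_coe, hb]
  rcases hE.mem_cases s hw with h | h | h | h
  · rw [hV.T_smul_minus s w h, hV'.T_smul_minus s w h, map_add, map_smul, hb, hb]
  · rw [hV.T_smul_plus s w h, hV'.T_smul_plus s w h, hb]
  · rw [hV.T_smul_zero_minus s w h, hV'.T_smul_zero_minus s w h, map_smul, hb]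
  · rw [hV.T_smul_zero_plus s w h, hV'.T_smul_zero_plus s w h, map_add, map_smul, hb]
    simp only [AddEquivClass.map_finsum, LinearEquiv.map_smul, hb]

/-- `Γ_1` generates the module: if `s w < w` then `Γ_w = T_s Γ_{sw}`, so that `Γ_w = T_w Γ_1`. -/
theorem IsWGraphIdealModule.exists_smul_one (hV : IsWGraphIdealModule cs L hE b r bar) (α : V) :
    ∃ h : HeckeAlgebra k M L, α = h • b ⟨1, hE.one_mem⟩ := by
  induction b.mem_span α using Submodule.span_induction with
  | mem x hx =>
    obtain ⟨⟨w, hw⟩, rfl⟩ := hx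
    induction hn : cs.length w using Nat.strong_induction_on generalizing w with
    | _ n ih =>
      subst hn
      by_cases h1 : w = 1
      · subst h1
        exact ⟨1, (one_smul _ _).symm⟩
      · obtain ⟨s, hs⟩ := cs.exists_leftDescent_of_ne_one h1
        have hsw := hE.simple_mul_mem hw hs
        obtain ⟨h, hh⟩ := ih _ hs (cs.simple s * w) hsw rfl
        refine ⟨HeckeAlgebra.T k M L s * h, ?_⟩
        have hp : cs.simple s * w ∈ EPlus cs E s :=
          ⟨hsw, by simpa [CoxeterSystem.IsLeftDescent] using hs, by simpa using hw⟩
        rw [mul_smul, ← hh, hV.T_smul_plus s _ hp]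
        simp
  | zero => exact ⟨0, (zero_smul _ _).symm⟩
  | add x y _ _ hx hy =>
    obtain ⟨g, rfl⟩ := hx
    obtain ⟨h, rfl⟩ := hy
    exact ⟨g + h, (add_smul _ _ _).symm⟩
  | smul a x _ hx =>
    obtain ⟨h, rfl⟩ := hx
    exact ⟨a • h, (smul_assoc _ _ _).symm⟩

/-- A `Φ`-semilinear map is determined by the image of `Γ_1`. Additivity is not needed. -/
theorem IsWGraphIdealModule.eq_of_map_smul (hV : IsWGraphIdealModule cs L hE b r bar)
    {X : Type*} [SMul (HeckeAlgebra k M L) X] {f g : V → X}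
    (h1 : f (b ⟨1, hE.one_mem⟩) = g (b ⟨1, hE.one_mem⟩))
    (hf : ∀ (h : HeckeAlgebra k M L) (α : V), f (h • α) = HeckeAlgebra.Phi k M L h • f α)
    (hg : ∀ (h : HeckeAlgebra k M L) (α : V), g (h • α) = HeckeAlgebra.Phi k M L h • g α) :
    f = g := by
  funext α
  obtain ⟨h, rfl⟩ := hV.exists_smul_one α
  rw [hf, hg, h1]

end Uniqueness

end

theorem mainTheorem1 (R : Subring ℂ)
    {Λ : Type*} [AddCommGroup Λ] [LinearOrder Λ] [IsOrderedAddMonoid Λ]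
    {B W : Type*} [Group W] {M : CoxeterMatrix B} (cs : CoxeterSystem M W)
    (L : B → Λ) (_hL : ∀ s t, IsConj (cs.simple s) (cs.simple t) → L s = L t)
    (_hL0 : ∀ s, 0 ≤ L s)
    (J : Set B) (E : Set W) (hE : IsWGraphIdeal.{v} R cs L J E)
    -- the module `M(E_J, L)` with its basis `Γ_w`, its polynomials `r` and its bar involution
    {V : Type v} [AddCommGroup V] [Module (AddMonoidAlgebra R Λ) V]
    [Module (HeckeAlgebra R M L) V]
    [IsScalarTower (AddMonoidAlgebra R Λ) (HeckeAlgebra R M L) V]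
    (b : Module.Basis E (AddMonoidAlgebra R Λ) V) (r : B → E → E → AddMonoidAlgebra R Λ)
    (bar : V →ₛₗ[barA R Λ] V) (_hV : IsWGraphIdealModule cs L hE.1 b r bar) :
    -- existence of the dual module
    (∃ (V' : Type v) (_ : AddCommGroup V') (_ : Module (AddMonoidAlgebra R Λ) V')
      (_ : Module (HeckeAlgebra R M L) V')
      (_ : IsScalarTower (AddMonoidAlgebra R Λ) (HeckeAlgebra R M L) V')
      (b' : Module.Basis E (AddMonoidAlgebra R Λ) V') (bar' : V' →ₛₗ[barA R Λ] V'),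
      IsDualWGraphIdealModule cs L hE.1 b' (dualCoeff cs r) bar') ∧
    -- the duality map from `M(E_J, L)` to any dual module
    (∀ (V' : Type v') [AddCommGroup V'] [Module (AddMonoidAlgebra R Λ) V']
      [Module (HeckeAlgebra R M L) V']
      [IsScalarTower (AddMonoidAlgebra R Λ) (HeckeAlgebra R M L) V']
      (b' : Module.Basis E (AddMonoidAlgebra R Λ) V') (bar' : V' →ₛₗ[barA R Λ] V'),
      IsDualWGraphIdealModule cs L hE.1 b' (dualCoeff cs r) bar' →
      ∃ η : V →ₛₗ[(HeckeAlgebra.Phi R M L).toRingHom] V',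
        η (b ⟨1, hE.1.one_mem⟩) = b' ⟨1, hE.1.one_mem⟩ ∧
        (∀ f : V → V', f (b ⟨1, hE.1.one_mem⟩) = b' ⟨1, hE.1.one_mem⟩ →
          (∀ (h : HeckeAlgebra R M L) (α : V), f (h • α) = HeckeAlgebra.Phi R M L h • f α) →
          f = η) ∧
        (∀ α, η (bar α) = bar' (η α)) ∧
        Function.Bijective η ∧
        ∃ θ : V' →ₛₗ[(HeckeAlgebra.Phi R M L).toRingHom] V,
          Function.LeftInverse θ η ∧ Function.RightInverse θ η ∧
          θ (b' ⟨1, hE.1.one_mem⟩) = b ⟨1, hE.1.one_mem⟩) := by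
  refine ⟨⟨PhiTwist R M L V, inferInstance, inferInstance, inferInstance, inferInstance,
    dualBasis cs b bar _hV.bar_bar, PhiTwist.barMap bar, _hV.isDual_phiTwist⟩, ?_⟩
  intro V' _ _ _ _ b' bar' hV'
  let e : V ≃ₗ[AddMonoidAlgebra R Λ] V' := (PhiTwist.of R M L V).trans
    ((dualBasis cs b bar _hV.bar_bar).equiv b' (Equiv.refl E))
  have he_smul : ∀ (h : HeckeAlgebra R M L) (α : V),
      e (h • α) = HeckeAlgebra.Phi R M L h • e α := fun h α => by
    simp only [e, LinearEquiv.trans_apply, PhiTwist.of_smul, _hV.isDual_phiTwist.equiv_smul hV']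
  have he_one : e (b ⟨1, hE.1.one_mem⟩) = b' ⟨1, hE.1.one_mem⟩ := by
    have h1 : PhiTwist.of R M L V (b ⟨1, hE.1.one_mem⟩) =
        dualBasis cs b bar _hV.bar_bar ⟨1, hE.1.one_mem⟩ := by
      rw [dualBasis_apply]
      simp [_hV.bar_one]
    simp [e, h1]
  have he_symm_smul : ∀ (h : HeckeAlgebra R M L) (α : V'),
      e.symm (h • α) = HeckeAlgebra.Phi R M L h • e.symm α := fun h α => by
    rw [LinearEquiv.symm_apply_eq, he_smul, HeckeAlgebra.Phi_Phi, LinearEquiv.apply_symm_apply]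
  have he_bar : (fun α => bar' (e (bar α))) = e :=
    _hV.eq_of_map_smul (by rw [_hV.bar_one, he_one, hV'.bar_one])
      (fun h α => by rw [_hV.bar_smul, he_smul, hV'.bar_smul, HeckeAlgebra.bar_Phi,
        HeckeAlgebra.bar_bar]) he_smul
  refine ⟨{ toFun := e, map_add' := map_add e, map_smul' := he_smul }, he_one,
    fun f hf1 hf => _hV.eq_of_map_smul (hf1.trans he_one.symm) hf he_smul, fun α => ?_,
    e.bijective, { toFun := e.symm, map_add' := map_add e.symm, map_smul' := he_symm_smul },
    e.symm_apply_apply, e.apply_symm_apply, ?_⟩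
  · have h := congrFun he_bar α
    change e (bar α) = bar' (e α)
    rw [← h, hV'.bar_bar]
  · change e.symm _ = _
    rw [LinearEquiv.symm_apply_eq, he_one]
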